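/- For a continuous map $f:X\to Y$, say that a subset $Z\subseteq Y$ carries a local homotopy section of $f$ if there is a continuous map $s:Z\to X$ such that $f\circ s$ is homotopic to the inclusion $Z\hookrightarrow Y$. Let $\operatorname{secat}(f)\in\{0,1,2,\dots\}\cup\{\infty\}$ be the least $n\ge 0$ such that $Y$ is the union of $n+1$ open subsets each of which carries a local homotopy section of $f$ (and $\infty$ if there is no such $n$), and let $\operatorname{secat}_g(f)$ be defined in the same way with $n+1$ arbitrary, not necessarily open, subsets of $Y$. An ANR is a metrizable space $K$ such that every continuous map into $K$ from a closed subset of a metrizable space $M$ extends continuously to an open neighbourhood of that subset in $M$. Let $f:X\to Y$ be a continuous map, where each of the spaces $X$ and $Y$ has the homotopy type of a CW-complex or of an ANR. Then $\operatorname{secat}(f)=\operatorname{secat}_g(f)$. -/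

import Mathlib

/-- `Z ⊆ Y` carries a local homotopy section of `f : X → Y`: a continuous map `s : Z → X` such that
`f ∘ s` is homotopic to the inclusion `Z ↪ Y`. -/
def HasLocalHomotopySection {X Y : Type*} [TopologicalSpace X] [TopologicalSpace Y]
    (f : C(X, Y)) (Z : Set Y) : Prop :=
  ∃ s : C(Z, X), (f.comp s).Homotopic ((ContinuousMap.id Y).restrict Z)

/-- The sectional category of `f : X → Y`: the least `n` such that `Y` is the union of `n + 1` open
subsets, each carrying a local homotopy section of `f`; it is `⊤` if there is no such `n`. -/
noncomputable def secat {X Y : Type*} [TopologicalSpace X] [TopologicalSpace Y]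
    (f : C(X, Y)) : ℕ∞ :=
  ⨅ (n : ℕ) (_ : ∃ U : Fin (n + 1) → Set Y, (∀ i, IsOpen (U i)) ∧ (⋃ i, U i) = Set.univ ∧
    ∀ i, HasLocalHomotopySection f (U i)), (n : ℕ∞)

/-- The generalized sectional category of `f : X → Y`: as `secat`, with covers by arbitrary
subsets of `Y`. -/
noncomputable def secatGen {X Y : Type*} [TopologicalSpace X] [TopologicalSpace Y]
    (f : C(X, Y)) : ℕ∞ :=
  ⨅ (n : ℕ) (_ : ∃ Z : Fin (n + 1) → Set Y, (⋃ i, Z i) = Set.univ ∧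
    ∀ i, HasLocalHomotopySection f (Z i)), (n : ℕ∞)

/-- An absolute neighbourhood retract (for metrizable spaces): a metrizable space `X` such that
every continuous map into `X` from a closed subset `A` of a metrizable space `M` extends
continuously to an open neighbourhood of `A` in `M`. -/
def IsANR.{u} (X : Type u) [TopologicalSpace X] : Prop :=
  TopologicalSpace.MetrizableSpace X ∧
    ∀ (M : Type u) [TopologicalSpace M] [TopologicalSpace.MetrizableSpace M] (A : Set M),
      IsClosed A → ∀ φ : C(A, X), ∃ (U : Set M) (hAU : A ⊆ U) (ψ : C(U, X)),
        IsOpen U ∧ ∀ a : A, ψ (Set.inclusion hAU a) = φ a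

/-- `X` is homotopy equivalent to an absolute neighbourhood retract. -/
def HasHomotopyTypeOfANR.{u} (X : Type u) [TopologicalSpace X] : Prop :=
  ∃ (K : Type u) (_ : TopologicalSpace K),
    IsANR K ∧ Nonempty (ContinuousMap.HomotopyEquiv X K)

/-- `X` is homotopy equivalent to a (Hausdorff) CW-complex. -/
def HasHomotopyTypeOfCW.{u} (X : Type u) [TopologicalSpace X] : Prop :=
  ∃ (K : Type u) (_ : TopologicalSpace K), T2Space K ∧
    Nonempty (Topology.CWComplex (Set.univ : Set K)) ∧
      Nonempty (ContinuousMap.HomotopyEquiv X K)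

/-! Open covers are among all covers, so only one inequality needs work: a local homotopy section
over an arbitrary subset must be spread to an open set. Call a set `C ∩ O`, with `C` convex and `O`
open in a normed space, a model. A map from any subset `Z` of a metrizable space to a model can be
averaged with a partition of unity. The average is defined near `Z` and joined on `Z` to the given
map by segments inside the model (`exists_open_extension_near`). Applied to maps and then to
homotopies, this extends a lift up to homotopy from `Z` to an open neighbourhood
(`exists_open_homotopy_lift`).

It then suffices that `X` and `Y` are homotopy retracts of models (`ConvexDominated`). Models are
metrizable even when `Y` is not: pull `Z` back along the retraction `r₂` to the model of `Y`,
thicken it there, and pull the result back along `i₂`.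

An ANR is a closed subset of the convex hull of its Kuratowski image, hence a retract of a
relatively open subset of that hull. A CW complex is mapped to an `ℓ^∞` space with one block `ℝⁿ ×
ℝ` for each `n`-cell. A homotopy left inverse is built skeleton by skeleton on open sets, and the
stages agree where the coordinates of later cells are small. -/

/-! ### Extending maps and homotopies from arbitrary subsets to open sets. -/

open Set Topology unitInterval in
theorem isOpen_setOf_segment_subset {E : Type*} [NormedAddCommGroup E] [NormedSpace ℝ E]
    {O : Set E} (hO : IsOpen O) : IsOpen {p : E × E | segment ℝ p.1 p.2 ⊆ O} := by
  have h : {p : E × E | segment ℝ p.1 p.2 ⊆ O} =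
      {p : E × E | ∀ t ∈ Icc (0 : ℝ) 1, AffineMap.lineMap p.1 p.2 t ∈ O} := by
    ext p
    simp only [segment_eq_image_lineMap, image_subset_iff, mem_ofPred_eq]
    rfl
  rw [h, isOpen_iff_eventually]
  intro p hp
  refine isCompact_Icc.eventually_forall_of_forall_eventually fun t ht => ?_
  have hc : Continuous fun q : (E × E) × ℝ => AffineMap.lineMap (k := ℝ) q.1.1 q.1.2 q.2 := by
    simp only [AffineMap.lineMap_apply_module]
    fun_prop
  exact hc.continuousAt.eventually_mem (hO.mem_nhds (hp t ht))

/-- Two maps into a subset of a normed space are homotopic if the segments that join their values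
stay in that subset. -/
theorem ContinuousMap.homotopic_of_segment_subset {A E : Type*} [TopologicalSpace A]
    [NormedAddCommGroup E] [NormedSpace ℝ E] {S : Set E} (f g : C(A, S))
    (h : ∀ a, segment ℝ (f a : E) (g a) ⊆ S) : f.Homotopic g := by
  refine ⟨⟨⟨fun p => ⟨AffineMap.lineMap (f p.2 : E) (g p.2 : E) (p.1 : ℝ), h p.2 ?_⟩, ?_⟩, ?_, ?_⟩⟩
  · rw [segment_eq_image_lineMap]
    exact ⟨p.1, p.1.2, rfl⟩
  · simp only [AffineMap.lineMap_apply_module]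
    fun_prop
  · intro x
    simp
  · intro x
    simp

open Set Topology in
/-- A map from an arbitrary subset of a metrizable space to a relatively open subset of a convex set
is homotopic, along segments, to one that extends to an open neighbourhood. -/
theorem exists_open_extension_near {M E : Type*} [TopologicalSpace M]
    [TopologicalSpace.MetrizableSpace M] [NormedAddCommGroup E] [NormedSpace ℝ E]
    {C O : Set E} (hC : Convex ℝ C) (hO : IsOpen O) {Z : Set M} (F : C(Z, E))
    (hF : ∀ z, F z ∈ C ∩ O) :
    ∃ (U : Set M) (G : M → E), IsOpen U ∧ Z ⊆ U ∧ ContinuousOn G U ∧ MapsTo G U (C ∩ O) ∧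
      ∀ z : Z, segment ℝ (G z) (F z) ⊆ C ∩ O := by
  classical
  let := TopologicalSpace.metrizableSpaceMetric M
  have h1 : ∀ z : Z, ∃ ε > 0, Metric.ball (F z) ε ⊆ O := fun z =>
    Metric.isOpen_iff.1 hO _ (hF z).2
  choose ε hε hεO using h1
  have h2 : ∀ z : Z, ∃ δ > 0, ∀ z' : Z, dist z' z < δ → dist (F z') (F z) < ε z := fun z =>
    Metric.continuousAt_iff.1 F.continuous.continuousAt (ε z) (hε z)
  choose δ hδ hδF using h2
  set U : Set M := ⋃ z : Z, Metric.ball (z : M) (δ z / 2) with hU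
  have hZU : Z ⊆ U := fun z hz => mem_iUnion.2 ⟨⟨z, hz⟩, Metric.mem_ball_self (half_pos (hδ _))⟩
  obtain ⟨ρ, hρ⟩ := PartitionOfUnity.exists_isSubordinate (X := U) isClosed_univ
    (fun z : Z => (Subtype.val ⁻¹' Metric.ball (z : M) (δ z / 2) : Set U))
    (fun z => Metric.isOpen_ball.preimage continuous_subtype_val)
    (fun u _ => by
      obtain ⟨z, hz⟩ := mem_iUnion.1 u.2
      exact mem_iUnion.2 ⟨z, hz⟩)
  have hsupp : ∀ (u : U) (z : Z), ρ z u ≠ 0 → dist (u : M) z < δ z / 2 := fun u z h =>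
    hρ z (subset_closure h)
  -- Among the finitely many indices active at `u`, take `z₀` with the largest radius. Since the
  -- balls have half radius, every active `z` is within `δ z₀` of `z₀`, so all averaged values lie
  -- in one ball inside `O`.
  have hmax : ∀ u : U, ∃ z₀ : Z, dist (u : M) z₀ < δ z₀ / 2 ∧
      ∀ z, ρ z u ≠ 0 → F z ∈ Metric.ball (F z₀) (ε z₀) := by
    intro u
    obtain ⟨z₁, hz₁⟩ := ρ.exists_pos (mem_univ u)
    obtain ⟨z₀, hz₀, hm⟩ := Set.exists_max_image {z | ρ z u ≠ 0} δ
      (ρ.locallyFinite.point_finite u) ⟨z₁, hz₁.ne'⟩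
    refine ⟨z₀, hsupp u z₀ hz₀, fun z hz => hδF z₀ z ?_⟩
    have := hm z hz
    have a := hsupp u z hz
    have b := hsupp u z₀ hz₀
    have := dist_triangle_left (z : M) z₀ u
    change dist (z : M) z₀ < _
    linarith
  let g : U → E := fun u => ∑ᶠ z, ρ z u • F z
  have hg : Continuous g := ρ.continuous_finsum_smul fun z u _ => continuousAt_const
  have hgmem : ∀ (u : U) (t : Set E), Convex ℝ t → (∀ z, ρ z u ≠ 0 → F z ∈ t) → g u ∈ t :=
    fun u t ht h => ρ.finsum_smul_mem_convex (g := fun z _ => F z) (mem_univ u) h ht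
  have hGg : ∀ u : U, (fun y => if h : y ∈ U then g ⟨y, h⟩ else 0 : M → E) u = g u := fun u => by
    simp [u.2]
  refine ⟨U, fun y => if h : y ∈ U then g ⟨y, h⟩ else 0,
    isOpen_iUnion fun z => Metric.isOpen_ball, hZU, ?_, ?_, ?_⟩
  · rw [continuousOn_iff_continuous_domRestrict]
    convert hg using 1
    exact funext hGg
  · intro u hu
    rw [hGg ⟨u, hu⟩]
    obtain ⟨z₀, -, hz₀⟩ := hmax ⟨u, hu⟩
    exact ⟨hgmem _ _ hC fun z _ => (hF z).1, hεO z₀ (hgmem _ _ (convex_ball _ _) hz₀)⟩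
  · intro z
    rw [hGg ⟨z, hZU z.2⟩]
    obtain ⟨z₀, hd, hz₀⟩ := hmax ⟨z, hZU z.2⟩
    refine subset_inter (hC.segment_subset (hgmem _ _ hC fun z _ => (hF z).1) (hF z).1)
      (Subset.trans ((convex_ball _ _).segment_subset (hgmem _ _ (convex_ball _ _) hz₀) ?_)
        (hεO z₀))
    refine hδF z₀ z ?_
    have := hδ z₀
    change dist (z : M) z₀ < _
    change dist (z : M) z₀ < _ at hd
    linarith

open Set Topology unitInterval in
/-- Maps into a relatively open subset of a convex set that are homotopic on an arbitrary subset of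
a metrizable space are homotopic on an open neighbourhood of it. -/
theorem exists_open_homotopic_restrict {M E : Type*} [TopologicalSpace M]
    [TopologicalSpace.MetrizableSpace M] [NormedAddCommGroup E] [NormedSpace ℝ E]
    {C O : Set E} (hC : Convex ℝ C) (hO : IsOpen O) (Z : Set M) (g h : C(M, ↥(C ∩ O)))
    (H : (g.restrict Z).Homotopic (h.restrict Z)) :
    ∃ V : Set M, IsOpen V ∧ Z ⊆ V ∧ (g.restrict V).Homotopic (h.restrict V) := by
  obtain ⟨H⟩ := H
  let Z' : Set (I × M) := {p | p.2 ∈ Z}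
  let F : C(Z', E) := ⟨fun p => H (p.1.1, ⟨p.1.2, p.2⟩), by fun_prop⟩
  obtain ⟨U, G, hU, hZU, hG, hGC, hseg⟩ :=
    exists_open_extension_near hC hO F (fun p => (H (p.1.1, ⟨p.1.2, p.2⟩)).2)
  -- The extended homotopy is available for all times over `V₁`, which is open by compactness of
  -- `I`.
  let V₁ : Set M := {m | ∀ t : I, (t, m) ∈ U}
  have hV₁ : IsOpen V₁ := by
    rw [isOpen_iff_eventually]
    intro m hm
    have := isCompact_univ.eventually_forall_of_forall_eventually (x₀ := m) (K := (univ : Set I))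
      (P := fun m t => (t, m) ∈ U) fun t _ =>
        (continuous_swap.continuousAt (x := (m, t))).eventually_mem (hU.mem_nhds (hm t))
    exact this.mono fun m h t => h t (mem_univ t)
  have hG' : ∀ t : I, ContinuousOn (fun m => G (t, m)) V₁ := fun t =>
    hG.comp (by fun_prop) fun m hm => hm t
  -- The ends of `G` are only near `g` and `h`, even on `Z`. Over `V` two straight-line homotopies
  -- inside `O` repair them.
  let V : Set M := (V₁ ∩ (fun m => ((g m : E), G (0, m))) ⁻¹' {p | segment ℝ p.1 p.2 ⊆ O}) ∩
    (V₁ ∩ (fun m => (G (1, m), (h m : E))) ⁻¹' {p | segment ℝ p.1 p.2 ⊆ O})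
  have hV : IsOpen V := by
    refine IsOpen.inter ?_ ?_
    · refine ContinuousOn.isOpen_inter_preimage ?_ hV₁ (isOpen_setOf_segment_subset hO)
      exact (by fun_prop : Continuous fun m => (g m : E)).continuousOn.prodMk (hG' 0)
    · refine ContinuousOn.isOpen_inter_preimage ?_ hV₁ (isOpen_setOf_segment_subset hO)
      exact (hG' 1).prodMk (by fun_prop : Continuous fun m => (h m : E)).continuousOn
  have hVU : ∀ (t : I) (v : V), (t, (v : M)) ∈ U := fun t v => v.2.1.1 t
  let K : C(I × V, ↥(C ∩ O)) := ⟨fun p => ⟨G (p.1, p.2), hGC (hVU _ _)⟩, by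
    refine Continuous.subtype_mk ?_ _
    exact hG.comp_continuous (by fun_prop) fun p => hVU _ _⟩
  let K₀ : C(V, ↥(C ∩ O)) := K.comp (.prodMk (.const _ 0) (.id _))
  let K₁ : C(V, ↥(C ∩ O)) := K.comp (.prodMk (.const _ 1) (.id _))
  have h01 : K₀.Homotopic K₁ := ⟨⟨K, fun _ => rfl, fun _ => rfl⟩⟩
  refine ⟨V, hV, ?_, .trans ?_ (.trans h01 ?_)⟩
  · intro z hz
    have hzV : z ∈ V₁ := fun t => hZU (show (t, z) ∈ Z' from hz)
    refine ⟨⟨hzV, ?_⟩, ⟨hzV, ?_⟩⟩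
    · have := hseg ⟨(0, z), hz⟩
      simp only [F, ContinuousMap.coe_mk, H.apply_zero, ContinuousMap.restrict_apply] at this
      change segment ℝ _ _ ⊆ O
      rw [segment_symm]
      exact this.trans inter_subset_right
    · have := hseg ⟨(1, z), hz⟩
      simp only [F, ContinuousMap.coe_mk, H.apply_one, ContinuousMap.restrict_apply] at this
      exact this.trans inter_subset_right
  · exact ContinuousMap.homotopic_of_segment_subset _ _ fun v => subset_inter
      (hC.segment_subset (g v).2.1 (K₀ v).2.1) v.2.1.2
  · exact ContinuousMap.homotopic_of_segment_subset _ _ fun v => subset_inter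
      (hC.segment_subset (K₁ v).2.1 (h v).2.1) v.2.2.2

open Set in
/-- A lift up to homotopy over an arbitrary subset of a metrizable space extends, up to homotopy,
to a lift over an open neighbourhood, for maps between relatively open subsets of convex sets. -/
theorem exists_open_homotopy_lift {M E₁ E₂ : Type*} [TopologicalSpace M]
    [TopologicalSpace.MetrizableSpace M] [NormedAddCommGroup E₁] [NormedSpace ℝ E₁]
    [NormedAddCommGroup E₂] [NormedSpace ℝ E₂] {C₁ O₁ : Set E₁} {C₂ O₂ : Set E₂}
    (hC₁ : Convex ℝ C₁) (hO₁ : IsOpen O₁) (hC₂ : Convex ℝ C₂) (hO₂ : IsOpen O₂)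
    (f : C(↥(C₁ ∩ O₁), ↥(C₂ ∩ O₂))) (e : C(M, ↥(C₂ ∩ O₂))) (Z : Set M) (s : C(Z, ↥(C₁ ∩ O₁)))
    (hs : (f.comp s).Homotopic (e.restrict Z)) :
    ∃ (V : Set M) (s' : C(V, ↥(C₁ ∩ O₁))), IsOpen V ∧ Z ⊆ V ∧
      (f.comp s').Homotopic (e.restrict V) := by
  obtain ⟨U, G, hU, hZU, hG, hGC, hseg⟩ := exists_open_extension_near hC₁ hO₁
    (⟨fun z => s z, by fun_prop⟩ : C(Z, E₁)) (fun z => (s z).2)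
  let g : C(U, ↥(C₁ ∩ O₁)) := ⟨fun u => ⟨G u, hGC u.2⟩, by
    refine Continuous.subtype_mk ?_ _
    exact hG.comp_continuous (by fun_prop) fun p => p.2⟩
  let Z' : Set U := Subtype.val ⁻¹' Z
  let k : C(Z', Z) := ⟨fun z => ⟨z.1.1, z.2⟩, by fun_prop⟩
  have h1 : (g.restrict Z').Homotopic (s.comp k) :=
    ContinuousMap.homotopic_of_segment_subset _ _ fun z => hseg ⟨z.1.1, z.2⟩
  -- The extension `g` of `s` is a lift up to homotopy on `Z` only; extending this homotopy shrinks
  -- `U` to an open set on which it is a lift.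
  have h2 : ((f.comp g).restrict Z').Homotopic ((e.restrict U).restrict Z') :=
    (ContinuousMap.Homotopic.comp (.refl f) h1).trans
      (ContinuousMap.Homotopic.comp hs (.refl k))
  obtain ⟨V, hV, hZV, hH⟩ := exists_open_homotopic_restrict hC₂ hO₂ Z' _ _ h2
  have hVU : ∀ v : ↥(Subtype.val '' V : Set M), ∃ h : (v : M) ∈ U, (⟨v, h⟩ : U) ∈ V := by
    rintro ⟨_, u, hu, rfl⟩
    exact ⟨u.2, hu⟩
  let l : C(↥(Subtype.val '' V : Set M), V) := ⟨fun v => ⟨⟨v, (hVU v).1⟩, (hVU v).2⟩, by fun_prop⟩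
  refine ⟨Subtype.val '' V, (g.restrict V).comp l, hU.isOpenMap_subtype_val V hV, ?_,
    ContinuousMap.Homotopic.comp hH (.refl l)⟩
  intro z hz
  exact ⟨⟨z, hZU hz⟩, hZV hz, rfl⟩

/-! ### Homotopy retracts of models and the comparison of covers. -/

/-- A space that is a homotopy retract of a relatively open subset of a convex subset of a normed
space. -/
def ConvexDominated.{u, v} (X : Type u) [TopologicalSpace X] : Prop :=
  ∃ (E : Type v) (_ : NormedAddCommGroup E) (_ : NormedSpace ℝ E) (C O : Set E),
    Convex ℝ C ∧ IsOpen O ∧ ∃ (i : C(X, ↥(C ∩ O))) (r : C(↥(C ∩ O), X)),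
      (r.comp i).Homotopic (ContinuousMap.id X)

theorem ConvexDominated.of_homotopyEquiv.{u, v} {X K : Type u} [TopologicalSpace X]
    [TopologicalSpace K] (hK : ConvexDominated.{u, v} K) (e : ContinuousMap.HomotopyEquiv X K) :
    ConvexDominated.{u, v} X := by
  obtain ⟨E, _, _, C, O, hC, hO, i, r, hir⟩ := hK
  refine ⟨E, _, _, C, O, hC, hO, i.comp e.toFun, e.invFun.comp r, ?_⟩
  have h : ((r.comp i).comp e.toFun).Homotopic e.toFun :=
    ContinuousMap.Homotopic.comp hir (.refl e.toFun)
  exact (ContinuousMap.Homotopic.comp (.refl e.invFun) h).trans e.left_inv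

/-- Thickening needs a metrizable base, so it takes place in the model of `Y`. The sets `i₂ ⁻¹' V j`
cover because `y` lies in the `j`-th one as soon as `r₂ (i₂ y) ∈ Z j`; `y` itself need not lie in `Z
j`. -/
theorem exists_open_cover_hasLocalHomotopySection.{u, v, u', v'} {X : Type u} {Y : Type v}
    [TopologicalSpace X] [TopologicalSpace Y] (hX : ConvexDominated.{u, u'} X)
    (hY : ConvexDominated.{v, v'} Y) (f : C(X, Y)) {ι : Type*} {Z : ι → Set Y}
    (hZ : ⋃ i, Z i = Set.univ) (hf : ∀ i, HasLocalHomotopySection f (Z i)) :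
    ∃ U : ι → Set Y, (∀ i, IsOpen (U i)) ∧ ⋃ i, U i = Set.univ ∧
      ∀ i, HasLocalHomotopySection f (U i) := by
  obtain ⟨E₁, _, _, C₁, O₁, hC₁, hO₁, i₁, r₁, h₁⟩ := hX
  obtain ⟨E₂, _, _, C₂, O₂, hC₂, hO₂, i₂, r₂, h₂⟩ := hY
  have key : ∀ j, ∃ V : Set ↥(C₂ ∩ O₂), IsOpen V ∧ r₂ ⁻¹' Z j ⊆ V ∧
      ∃ s : C(V, ↥(C₁ ∩ O₁)), (((i₂.comp f).comp r₁).comp s).Homotopic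
        ((i₂.comp r₂).restrict V) := by
    intro j
    obtain ⟨s, hs⟩ := hf j
    let k : C(r₂ ⁻¹' Z j, Z j) := ⟨fun w => ⟨r₂ w, w.2⟩, by fun_prop⟩
    have h3 : (((i₂.comp f).comp r₁).comp ((i₁.comp s).comp k)).Homotopic
        ((i₂.comp r₂).restrict (r₂ ⁻¹' Z j)) :=
      (ContinuousMap.Homotopic.comp (.refl (i₂.comp f))
        (ContinuousMap.Homotopic.comp h₁ (.refl (s.comp k)))).trans
        (ContinuousMap.Homotopic.comp (.refl i₂) (ContinuousMap.Homotopic.comp hs (.refl k)))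
    obtain ⟨V, s', hV, hZV, hs'⟩ := exists_open_homotopy_lift hC₁ hO₁ hC₂ hO₂ _ _ _ _ h3
    exact ⟨V, hV, hZV, s', hs'⟩
  choose V hV hZV s hs using key
  refine ⟨fun j => i₂ ⁻¹' V j, fun j => (hV j).preimage i₂.continuous, ?_, fun j => ?_⟩
  · refine Set.eq_univ_of_forall fun y => ?_
    obtain ⟨j, hj⟩ := Set.mem_iUnion.1 (hZ ▸ Set.mem_univ (r₂ (i₂ y)))
    exact Set.mem_iUnion.2 ⟨j, hZV j hj⟩
  · let k : C(i₂ ⁻¹' V j, V j) := ⟨fun y => ⟨i₂ y, y.2⟩, by fun_prop⟩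
    let l : C(i₂ ⁻¹' V j, Y) := ⟨Subtype.val, continuous_subtype_val⟩
    refine ⟨(r₁.comp (s j)).comp k, ?_⟩
    -- With `k` induced by `i₂`, the chain is `f r₁ s k ≃ r₂ i₂ f r₁ s k ≃ r₂ i₂ r₂ i₂ l ≃ l`.
    have a : ((r₂.comp i₂).comp ((f.comp r₁).comp ((s j).comp k))).Homotopic
        ((f.comp r₁).comp ((s j).comp k)) := ContinuousMap.Homotopic.comp h₂ (.refl _)
    have b : (r₂.comp ((((i₂.comp f).comp r₁).comp (s j)).comp k)).Homotopic
        (r₂.comp (((i₂.comp r₂).restrict (V j)).comp k)) :=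
      ContinuousMap.Homotopic.comp (.refl r₂) (ContinuousMap.Homotopic.comp (hs j) (.refl k))
    have c : ((r₂.comp i₂).comp ((r₂.comp i₂).comp l)).Homotopic l :=
      ContinuousMap.Homotopic.comp h₂ (ContinuousMap.Homotopic.comp h₂ (.refl l))
    exact a.symm.trans (b.trans c)

theorem secat_eq_secatGen_of_convexDominated.{u, v, u', v'} {X : Type u} {Y : Type v}
    [TopologicalSpace X] [TopologicalSpace Y] (hX : ConvexDominated.{u, u'} X)
    (hY : ConvexDominated.{v, v'} Y) (f : C(X, Y)) : secat f = secatGen f := by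
  unfold secat secatGen
  refine le_antisymm ?_ ?_
  · refine le_iInf₂ fun n ⟨Z, hZ, hf⟩ => iInf₂_le n ?_
    exact exists_open_cover_hasLocalHomotopySection hX hY f hZ hf
  · refine le_iInf₂ fun n ⟨U, _, hU, hf⟩ => iInf₂_le n ⟨U, hU, hf⟩

/-! ### ANRs: the Kuratowski–Wojdysławski embedding. -/

open Set Topology BoundedContinuousFunction in
/-- An absolute neighbourhood retract is a retract of a relatively open subset of a convex subset of
a normed space. -/
theorem IsANR.convexDominated.{u} {K : Type u} [TopologicalSpace K] (hK : IsANR K) :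
    ConvexDominated.{u, u} K := by
  obtain ⟨hM, hext⟩ := hK
  let := TopologicalSpace.metrizableSpaceMetric K
  -- Distances are truncated at 1 so that the functions are bounded without any base point.
  let j : K → (K →ᵇ ℝ) := fun x => BoundedContinuousFunction.ofNormedAddCommGroup
    (fun y => min (dist x y) 1) (by fun_prop) 1 fun y => by
      rw [Real.norm_of_nonneg (by positivity)]
      exact min_le_right _ _
  have hj : ∀ x y, j x y = min (dist x y) 1 := fun _ _ => rfl
  have hle : ∀ x y, dist (j x) (j y) ≤ dist x y := fun x y => by
    refine (BoundedContinuousFunction.dist_le dist_nonneg).2 fun z => ?_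
    rw [hj, hj, Real.dist_eq]
    exact (abs_min_sub_min_le_max _ _ _ _).trans (by simpa using abs_dist_sub_le x y z)
  have hge : ∀ x y, min (dist x y) 1 ≤ dist (j x) (j y) := fun x y => by
    have := BoundedContinuousFunction.dist_coe_le_dist (f := j x) (g := j y) y
    rw [hj, hj, dist_self, Real.dist_eq] at this
    simpa [abs_of_nonneg (show 0 ≤ min (dist x y) 1 by positivity)] using this
  have hjc : Continuous j := (LipschitzWith.of_dist_le_mul (K := 1) (by simpa using hle)).continuous
  have hinv : ∀ (x : K) (ε : ℝ), 0 < ε → ∃ δ > 0, ∀ y, dist (j y) (j x) < δ → dist y x < ε := by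
    intro x ε hε
    refine ⟨min ε 1, by positivity, fun y hy => ?_⟩
    have := (hge y x).trans_lt hy
    by_contra! h
    exact absurd this (not_lt.2 (min_le_min_right 1 h))
  have hinj : Function.Injective j := fun x y h => by
    have := hge x y
    rw [h, dist_self] at this
    by_contra hne
    exact absurd this (not_le.2 (lt_min (dist_pos.2 hne) one_pos))
  let C : Set (K →ᵇ ℝ) := convexHull ℝ (range j)
  have hjC : ∀ x, j x ∈ C := fun x => subset_convexHull ℝ _ ⟨x, rfl⟩
  let A : Set C := {c | (c : K →ᵇ ℝ) ∈ range j}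
  -- Write a limit point `c` as a convex combination in which `j x` has weight `w i > 0`. All terms
  -- are nonnegative, so `w i * min (dist x y) 1 ≤ c y`. If `j y` is close to `c`, then `c y` is
  -- close to `j y y = 0`, so `y` is close to `x`; hence `c = j x`.
  have hA : IsClosed A := by
    rw [← closure_subset_iff_isClosed]
    intro c hc
    have hclose : ∀ ε > 0, ∃ y, dist (c : K →ᵇ ℝ) (j y) < ε := by
      intro ε hε
      obtain ⟨b, ⟨y, hy⟩, hb⟩ := Metric.mem_closure_iff.1 hc ε hε
      exact ⟨y, by rw [hy]; exact hb⟩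
    obtain ⟨ι, _, w, z, hw, hw1, hz, hcz⟩ := (mem_convexHull_iff_exists_fintype (R := ℝ)).1 c.2
    obtain ⟨i, hi⟩ : ∃ i, 0 < w i := by
      by_contra! h
      have : ∑ i, w i ≤ 0 := Finset.sum_nonpos fun i _ => h i
      linarith
    obtain ⟨x, hx⟩ := hz i
    refine ⟨x, ?_⟩
    have hcy : ∀ y, w i * min (dist x y) 1 ≤ (c : K →ᵇ ℝ) y := by
      intro y
      rw [← hcz, BoundedContinuousFunction.sum_apply]
      rw [show w i * min (dist x y) 1 = (w i • z i) y by rw [← hx]; rfl]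
      refine Finset.single_le_sum (f := fun k => (w k • z k) y) (fun k _ => ?_) (Finset.mem_univ i)
      obtain ⟨x', hx'⟩ := hz k
      change 0 ≤ w k * z k y
      rw [← hx']
      exact mul_nonneg (hw k) (le_min dist_nonneg zero_le_one)
    rw [← dist_le_zero]
    refine le_of_forall_pos_le_add fun ε hε => ?_
    obtain ⟨δ, hδ, hδ'⟩ : ∃ δ > 0, δ / w i < min (ε / 2) 1 ∧ δ < ε / 2 := by
      refine ⟨min (w i * min (ε / 2) 1 / 2) (ε / 4), by positivity, ?_, ?_⟩
      · rw [div_lt_iff₀ hi]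
        refine (min_le_left _ _).trans_lt ?_
        have : 0 < w i * min (ε / 2) 1 := by positivity
        linarith
      · exact (min_le_right _ _).trans_lt (by linarith)
    obtain ⟨y, hy⟩ := hclose δ hδ
    have h1 : (c : K →ᵇ ℝ) y < δ := by
      have := (BoundedContinuousFunction.dist_coe_le_dist (f := (c : K →ᵇ ℝ)) (g := j y) y).trans_lt
        hy
      rw [hj, dist_self, Real.dist_eq] at this
      have := le_abs_self ((c : K →ᵇ ℝ) y - min 0 1)
      simp at *
      linarith
    have h2 : min (dist x y) 1 < min (ε / 2) 1 := by
      refine lt_of_le_of_lt ?_ hδ'.1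
      rw [le_div_iff₀ hi]
      linarith [hcy y]
    have h3 : dist x y < ε / 2 := by
      by_contra! h
      exact absurd h2 (not_lt.2 (min_le_min_right 1 h))
    have := dist_triangle_right (j x) c (j y)
    linarith [hle x y]
  choose g hgj using fun a : A => show ∃ x, j x = (a : C) from a.2
  -- The inverse of the embedding; the ANR property extends it to a relatively open subset of the
  -- hull.
  let φ : C(A, K) := ⟨fun a => g a, by
    rw [Metric.continuous_iff]
    intro b ε hε
    obtain ⟨δ, hδ, h⟩ := hinv (g b) ε hε
    refine ⟨δ, hδ, fun a ha => h _ ?_⟩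
    rw [hgj, hgj]
    exact ha⟩
  obtain ⟨U, hAU, ψ, hU, hψ⟩ := hext C A hA φ
  obtain ⟨O, hO, hOU⟩ := isOpen_induced_iff.1 hU
  have hmem : ∀ x, (⟨j x, hjC x⟩ : C) ∈ A := fun x => ⟨x, rfl⟩
  have hUO : ∀ w : ↥(C ∩ O), (⟨w, w.2.1⟩ : C) ∈ U := fun w => by
    rw [← hOU]
    exact w.2.2
  refine ⟨K →ᵇ ℝ, inferInstance, inferInstance, C, O, convex_convexHull ℝ _, hO,
    ⟨fun x => ⟨j x, hjC x, ?_⟩, by fun_prop⟩,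
    ψ.comp ⟨fun w => ⟨⟨w, w.2.1⟩, hUO w⟩, by fun_prop⟩, ?_⟩
  · have := hAU (hmem x)
    rw [← hOU] at this
    exact this
  · convert ContinuousMap.Homotopic.refl _
    ext x
    have := hψ ⟨⟨j x, hjC x⟩, hmem x⟩
    refine Eq.trans (hinj ?_).symm this.symm
    exact hgj ⟨⟨j x, hjC x⟩, hmem x⟩

/-! ### Continuity and extension of functions on skeleta. -/

open Set Topology in
/-- A function on a skeleton of a CW complex is continuous if it is continuous on every cell. -/
theorem Topology.CWComplex.continuousOn_skeletonLT {K T : Type*} [TopologicalSpace K] [T2Space K]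
    [CWComplex (univ : Set K)] [TopologicalSpace T] {f : K → T} (n : ℕ)
    (hf : ∀ m < n, ∀ j : RelCWComplex.cell (univ : Set K) m,
      ContinuousOn (f ∘ RelCWComplex.map m j) (Metric.closedBall 0 1)) :
    ContinuousOn f (RelCWComplex.skeletonLT (univ : Set K) n : Set K) := by
  rw [continuousOn_iff_isClosed]
  intro S hS
  refine ⟨f ⁻¹' S ∩ RelCWComplex.skeletonLT (univ : Set K) n, ?_, by simp [inter_assoc]⟩
  refine CWComplex.isClosed_of_disjoint_openCell_or_isClosed_inter_closedCell (subset_univ _)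
    fun m _ j => ?_
  by_cases hm : m < n
  · right
    have hsub : RelCWComplex.closedCell m j ⊆
        (RelCWComplex.skeletonLT (univ : Set K) n : Set K) :=
      (RelCWComplex.closedCell_subset_skeletonLT m j).trans
        (RelCWComplex.skeletonLT_mono (by exact_mod_cast hm))
    rw [inter_assoc, inter_eq_right.2 hsub]
    have h : f ⁻¹' S ∩ RelCWComplex.closedCell m j =
        RelCWComplex.map m j '' (Metric.closedBall 0 1 ∩ (f ∘ RelCWComplex.map m j) ⁻¹' S) := by
      rw [RelCWComplex.closedCell, inter_comm, ← image_inter_preimage]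
      rfl
    rw [h]
    refine IsCompact.isClosed (IsCompact.image_of_continuousOn ?_
      ((RelCWComplex.continuousOn m j).mono inter_subset_left))
    exact (isCompact_closedBall _ _).of_isClosed_subset
      ((hf m hm j).preimage_isClosed_of_isClosed Metric.isClosed_closedBall hS) inter_subset_left
  · left
    exact (RelCWComplex.disjoint_skeletonLT_openCell (by exact_mod_cast not_lt.1 hm)).mono_left
      inter_subset_right

open Set Topology in
theorem Topology.CWComplex.mem_skeletonLT_succ {K : Type*} [TopologicalSpace K]
    [T2Space K] [CWComplex (univ : Set K)] {n : ℕ} {x : K} :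
    x ∈ (RelCWComplex.skeletonLT (univ : Set K) (n + 1 : ℕ) : Set K) ↔
      x ∈ (RelCWComplex.skeletonLT (univ : Set K) n : Set K) ∨
      ∃ (j : RelCWComplex.cell (univ : Set K) n) (p : Fin n → ℝ), ‖p‖ ≤ 1 ∧
        RelCWComplex.map n j p = x := by
  push_cast
  rw [← RelCWComplex.skeletonLT_union_iUnion_closedCell_eq_skeletonLT_succ]
  simp [RelCWComplex.closedCell]

open Set Topology in
/-- A function on a skeleton of a CW complex extends over the cells of the next dimension as soon as
it does so over every single cell. -/
theorem Topology.CWComplex.exists_extension_skeletonLT_succ {K T : Type*} [TopologicalSpace K]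
    [T2Space K] [CWComplex (univ : Set K)] [TopologicalSpace T] (n : ℕ) (g : K → T)
    (hg : ContinuousOn g (RelCWComplex.skeletonLT (univ : Set K) n : Set K))
    (h : RelCWComplex.cell (univ : Set K) n → (Fin n → ℝ) → T)
    (hh : ∀ j, ContinuousOn (h j) (Metric.closedBall 0 1))
    (hgh : ∀ j p, ‖p‖ = 1 → h j p = g (RelCWComplex.map n j p)) :
    ∃ g' : K → T, ContinuousOn g' (RelCWComplex.skeletonLT (univ : Set K) (n + 1 : ℕ) : Set K) ∧
      (∀ x ∈ (RelCWComplex.skeletonLT (univ : Set K) n : Set K), g' x = g x) ∧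
      ∀ j p, ‖p‖ ≤ 1 → g' (RelCWComplex.map n j p) = h j p := by
  classical
  let g' : K → T := fun x => if hx : ∃ j, x ∈ RelCWComplex.openCell (C := (univ : Set K)) n j then
    h hx.choose ((RelCWComplex.map n hx.choose).symm x) else g x
  have h1 : ∀ x ∈ (RelCWComplex.skeletonLT (univ : Set K) n : Set K), g' x = g x := by
    intro x hx
    refine dif_neg ?_
    rintro ⟨j, hj⟩
    exact disjoint_left.1 (RelCWComplex.disjoint_skeletonLT_openCell le_rfl) hx hj
  have h2 : ∀ j p, ‖p‖ ≤ 1 → g' (RelCWComplex.map n j p) = h j p := by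
    intro j p hp
    rcases hp.lt_or_eq with hp | hp
    · have hb : p ∈ Metric.ball (0 : Fin n → ℝ) 1 := by simpa using hp
      have hx : ∃ k, RelCWComplex.map n j p ∈ RelCWComplex.openCell (C := (univ : Set K)) n k :=
        ⟨j, p, hb, rfl⟩
      have hk : hx.choose = j := by
        by_contra hne
        exact disjoint_left.1 (RelCWComplex.disjoint_openCell_of_ne
          (i := hx.choose) (j := j) (by simpa using hne)) hx.choose_spec ⟨p, hb, rfl⟩
      refine (dif_pos hx).trans ?_
      rw [hk, PartialEquiv.left_inv]
      rwa [RelCWComplex.source_eq]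
    · rw [h1, hgh j p hp]
      exact RelCWComplex.cellFrontier_subset_skeletonLT n j ⟨p, by simpa using hp, rfl⟩
  refine ⟨g', CWComplex.continuousOn_skeletonLT _ fun m hm j => ?_, h1, h2⟩
  rcases (Nat.lt_succ_iff.1 hm).lt_or_eq with hm | rfl
  · have hmaps : MapsTo (RelCWComplex.map m j) (Metric.closedBall 0 1)
        (RelCWComplex.skeletonLT (univ : Set K) n : Set K) := fun p hp =>
      RelCWComplex.skeletonLT_mono (show ((m : ℕ∞) + 1) ≤ n by exact_mod_cast hm)
        (RelCWComplex.closedCell_subset_skeletonLT m j ⟨p, hp, rfl⟩)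
    exact (hg.comp (RelCWComplex.continuousOn m j) hmaps).congr fun p hp => h1 _ (hmaps hp)
  · exact (hh j).congr fun p hp => h2 j p (by simpa using hp)

/-! ### Radial constructions on the unit ball and its collar. -/

theorem norm_inv_norm_smul {V : Type*} [NormedAddCommGroup V] [NormedSpace ℝ V] {p : V}
    (hp : p ≠ 0) : ‖‖p‖⁻¹ • p‖ = 1 := by
  rw [norm_smul, norm_inv, norm_norm, inv_mul_cancel₀ (norm_ne_zero_iff.2 hp)]

open Set Topology in
/-- The radial extension of a function on the unit sphere, cut off near the origin. -/
theorem continuous_min_norm_smul {V L : Type*} [NormedAddCommGroup V] [NormedSpace ℝ V]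
    [ProperSpace V] [NormedAddCommGroup L] [NormedSpace ℝ L] {f : V → L}
    (hf : ContinuousOn f (Metric.sphere 0 1)) :
    Continuous fun p => min 1 (2 * ‖p‖) • f (‖p‖⁻¹ • p) := by
  rw [continuous_iff_continuousAt]
  intro p
  by_cases hp : p = 0
  · subst hp
    obtain ⟨B, hB⟩ := ((isCompact_sphere (0 : V) 1).image_of_continuousOn hf).isBounded.exists_norm_le
    have hz : Filter.Tendsto (fun p : V => 2 * ‖p‖ * |B|) (𝓝 0) (𝓝 0) := by
      have : Continuous fun p : V => 2 * ‖p‖ * |B| := by fun_prop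
      simpa using this.tendsto 0
    rw [ContinuousAt]
    simp only [norm_zero, mul_zero, inv_zero, zero_smul, min_eq_right zero_le_one]
    refine squeeze_zero_norm (fun p => ?_) hz
    by_cases hp : p = 0
    · simp [hp]
    rw [norm_smul, Real.norm_of_nonneg (by positivity)]
    gcongr
    · exact min_le_right _ _
    · exact (hB _ ⟨_, by simpa using norm_inv_norm_smul hp, rfl⟩).trans (le_abs_self B)
  · have hc : ContinuousOn (fun p : V => f (‖p‖⁻¹ • p)) {p | p ≠ 0} := by
      refine hf.comp (t := Metric.sphere 0 1) ?_ fun p hp => by simpa using norm_inv_norm_smul hp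
      exact (continuousOn_id.norm.inv₀ fun p hp => norm_ne_zero_iff.2 hp).smul continuousOn_id
    have : ContinuousAt (fun p : V => f (‖p‖⁻¹ • p)) p := hc.continuousAt (isOpen_ne.mem_nhds hp)
    exact (by fun_prop : Continuous fun p : V => min 1 (2 * ‖p‖)).continuousAt.smul this

open Set Topology unitInterval in
/-- A map on the closed unit ball, together with a homotopy of its restriction to the sphere,
assembles to a map on the whole space. -/
theorem exists_continuous_collar_extension {V K : Type*} [NormedAddCommGroup V] [NormedSpace ℝ V]
    [TopologicalSpace K] {φ : V → K} (hφ : ContinuousOn φ (Metric.closedBall 0 1))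
    {h : V → C(I, K)} (hh : ContinuousOn h (Metric.sphere 0 1))
    (h1 : ∀ p, ‖p‖ = 1 → h p 1 = φ p) :
    ∃ E : V → K, Continuous E ∧ (∀ p, ‖p‖ ≤ 1 → E p = φ p) ∧
      ∀ p (t : I), ‖p‖ = 1 → E ((2 - (t : ℝ)) • p) = h p t := by
  -- Homotopy time runs from 1 on the unit sphere to 0 on the sphere of radius 2, and stays 0 beyond
  -- it.
  let c : V → I := fun y => projIcc 0 1 zero_le_one (2 - ‖y‖)
  have hne : ∀ y : V, 1 ≤ ‖y‖ → y ≠ 0 := fun y hy => norm_pos_iff.1 (by linarith)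
  have hbd : ∀ y : V, ‖y‖ = 1 → φ y = h (‖y‖⁻¹ • y) (c y) := by
    intro y hy
    have : c y = 1 := by
      simp only [c, hy]
      exact projIcc_of_right_le _ (by norm_num)
    rw [this, hy, inv_one, one_smul, h1 y hy]
  refine ⟨fun y => if ‖y‖ ≤ 1 then φ y else h (‖y‖⁻¹ • y) (c y), ?_, fun p hp => if_pos hp, ?_⟩
  · refine continuous_if_le continuous_norm continuous_const (hφ.mono fun y hy => by
      simpa using hy) ?_ fun y hy => hbd y hy
    have h1 : ContinuousOn (fun y : V => h (‖y‖⁻¹ • y)) {y | 1 ≤ ‖y‖} := by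
      refine hh.comp (t := Metric.sphere 0 1) ?_
        fun p hp => by simpa using norm_inv_norm_smul (hne p hp)
      exact (continuousOn_id.norm.inv₀ fun p hp => norm_ne_zero_iff.2 (hne p hp)).smul
        continuousOn_id
    have h2 : ContinuousOn c {y | 1 ≤ ‖y‖} :=
      (continuous_projIcc.comp (by fun_prop : Continuous fun y : V => 2 - ‖y‖)).continuousOn
    exact (ContinuousEval.continuous_eval (F := C(I, K))).comp_continuousOn (h1.prodMk h2)
  · intro p t hp
    have ht : (0 : ℝ) ≤ 2 - t := by linarith [t.2.2]
    have hn : ‖(2 - (t : ℝ)) • p‖ = 2 - t := by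
      rw [norm_smul, hp, mul_one, Real.norm_of_nonneg ht]
    have hval : h (‖(2 - (t : ℝ)) • p‖⁻¹ • (2 - (t : ℝ)) • p) (c ((2 - (t : ℝ)) • p)) = h p t := by
      have : c ((2 - (t : ℝ)) • p) = t := by
        simp only [c, hn]
        rw [sub_sub_cancel]
        exact projIcc_val _ t
      rw [this, hn, smul_smul, inv_mul_cancel₀ (by linarith [t.2.2]), one_smul]
    dsimp only
    split_ifs with hle
    · rw [← hval]
      refine hbd _ (le_antisymm hle ?_)
      rw [hn]
      linarith [t.2.2]
    · exact hval

section CollarMap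

variable {V L K : Type*} [NormedAddCommGroup V] [NormedSpace ℝ V] [NormedAddCommGroup L]
  [NormedSpace ℝ L]

/-- For `τ ≤ 1 / 2`, push `w` along the segment to `b` and apply `r`; for `τ ≥ 1 / 2`, apply `E` to a
radial rescaling of `v`. -/
noncomputable def collarMap (r : L → K) (E : V → K) (w b : L) (v : V) (τ : ℝ) : K :=
  open scoped Classical in
  -- The line parameter is 0 up to `τ = 1 / 4` and reaches 1 at `τ = 1 / 2`, where the other formula
  -- reads `E (2 v / ‖v‖)`; the two agree there when `r b` has this value. For `τ > 1 / 2` the term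
  -- `τ * (2 * τ - 1)` keeps the denominator positive, so `v = 0` is harmless.
  if τ ≤ 1 / 2 then r (AffineMap.lineMap w b (max 0 (min 1 (4 * τ - 1))))
  else E ((2 / max ‖v‖ (τ * (2 * τ - 1))) • v)

theorem collarMap_of_lt (r : L → K) (E : V → K) (w b : L) (v : V) {τ : ℝ} (h : τ < 1 / 4) :
    collarMap r E w b v τ = r w := by
  rw [collarMap, if_pos (by linarith), max_eq_left ((min_le_right _ _).trans (by linarith)),
    AffineMap.lineMap_apply_zero]

theorem collarMap_of_le (r : L → K) (E : V → K) (w b : L) (v : V) {τ : ℝ} (h : τ ≤ 1 / 2) :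
    collarMap r E w b v τ = r (AffineMap.lineMap w b (max 0 (min 1 (4 * τ - 1)))) :=
  if_pos h

theorem collarMap_of_half_lt (r : L → K) (E : V → K) (w b : L) (v : V) {τ : ℝ} (h : 1 / 2 < τ) :
    collarMap r E w b v τ = E ((2 / max ‖v‖ (τ * (2 * τ - 1))) • v) :=
  if_neg (not_le.2 h)

theorem segment_subset_iff_lineMap_mem {w b : L} {W : Set L} :
    segment ℝ w b ⊆ W ↔ ∀ t ∈ Set.Icc (0 : ℝ) 1, AffineMap.lineMap w b t ∈ W := by
  rw [segment_eq_image_lineMap, Set.image_subset_iff]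
  rfl

theorem lineMap_max_min_mem {w b : L} {W : Set L} (h : segment ℝ w b ⊆ W) (τ : ℝ) :
    AffineMap.lineMap w b (max 0 (min 1 (4 * τ - 1))) ∈ W := by
  exact segment_subset_iff_lineMap_mem.1 h _
    ⟨le_max_left _ _, max_le zero_le_one (min_le_left _ _)⟩

variable {X : Type*} [TopologicalSpace X] [TopologicalSpace K] {W : Set L} {r : L → K} {E : V → K}
  {w b : X → L} {v : X → V} {τ : X → ℝ}

theorem continuous_collarMap (hr : ContinuousOn r W) (hE : Continuous E) (hw : Continuous w)
    (hb : Continuous b) (hv : Continuous v) (hτ : Continuous τ) (hv0 : ∀ x, v x ≠ 0)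
    (hseg : ∀ x, segment ℝ (w x) (b x) ⊆ W)
    (hrE : ∀ x, r (b x) = E ((2 : ℝ) • ‖v x‖⁻¹ • v x)) :
    Continuous fun x => collarMap r E (w x) (b x) (v x) (τ x) := by
  unfold collarMap
  refine continuous_if_le hτ continuous_const ?_ ?_ ?_
  · refine Continuous.continuousOn (hr.comp_continuous ?_ fun x => lineMap_max_min_mem (hseg x) _)
    simp only [AffineMap.lineMap_apply_module]
    fun_prop
  · refine (hE.comp (Continuous.smul (Continuous.div continuous_const (by fun_prop) fun x => ?_)
      hv)).continuousOn
    exact (lt_max_of_lt_left (norm_pos_iff.2 (hv0 x))).ne'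
  · intro x hx
    have h1 : max (0 : ℝ) (min 1 (4 * τ x - 1)) = 1 := by
      rw [hx]
      norm_num
    have h2 : max ‖v x‖ (τ x * (2 * τ x - 1)) = ‖v x‖ := by
      rw [hx]
      norm_num
    rw [h1, h2, AffineMap.lineMap_apply_one, div_eq_mul_inv, mul_smul]
    exact hrE x

theorem continuous_collarMap_of_half_lt (hE : Continuous E) (hv : Continuous v) (hτ : Continuous τ)
    (h : ∀ x, 1 / 2 < τ x) : Continuous fun x => collarMap r E (w x) (b x) (v x) (τ x) := by
  simp only [fun x => collarMap_of_half_lt r E (w x) (b x) (v x) (h x)]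
  refine hE.comp (Continuous.smul (Continuous.div continuous_const (by fun_prop) fun x => ?_) hv)
  have := h x
  exact (lt_max_of_lt_right (mul_pos (by linarith) (by linarith))).ne'

end CollarMap

/-! ### The space of cell coordinates. -/

open scoped ENNReal in
/-- Bounded families of vectors, with one vector of `ℝⁿ × ℝ` for every `n`-cell. -/
def CellCoordinates.{u} (cell : ℕ → Type u) : Type u :=
  lp (fun β : Σ n, cell n => (Fin β.1 → ℝ) × ℝ) ∞

open scoped ENNReal in
noncomputable instance CellCoordinates.instNormedAddCommGroup.{u} (cell : ℕ → Type u) :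
    NormedAddCommGroup (CellCoordinates cell) :=
  inferInstanceAs (NormedAddCommGroup (lp (fun β : Σ n, cell n => (Fin β.1 → ℝ) × ℝ) ∞))

open scoped ENNReal in
noncomputable instance CellCoordinates.instNormedSpace.{u} (cell : ℕ → Type u) :
    NormedSpace ℝ (CellCoordinates cell) :=
  inferInstanceAs (NormedSpace ℝ (lp (fun β : Σ n, cell n => (Fin β.1 → ℝ) × ℝ) ∞))

instance CellCoordinates.instCoeFun.{u} (cell : ℕ → Type u) :
    CoeFun (CellCoordinates cell) fun _ => ∀ β : Σ n, cell n, (Fin β.1 → ℝ) × ℝ :=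
  ⟨fun w => w.1⟩

/-- The families whose real coordinates on `P` are bounded away from `1 / 4`. -/
def CellCoordinates.smallOn.{u} {cell : ℕ → Type u} (P : Set (Σ n, cell n)) :
    Set (CellCoordinates cell) :=
  {w | ∃ ε > 0, ∀ β ∈ P, (w β).2 ≤ 1 / 4 - ε}

namespace CellCoordinates

universe u

variable {cell : ℕ → Type u}

theorem add_apply (w w' : CellCoordinates cell) (β : Σ n, cell n) : (w + w') β = w β + w' β :=
  rfl

theorem smul_apply (c : ℝ) (w : CellCoordinates cell) (β : Σ n, cell n) : (c • w) β = c • w β :=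
  rfl

open scoped Classical ENNReal in
/-- The family that is zero away from the cell `β`. -/
noncomputable def single (β : Σ n, cell n) (q : (Fin β.1 → ℝ) × ℝ) : CellCoordinates cell :=
  lp.single (E := fun β : Σ n, cell n => (Fin β.1 → ℝ) × ℝ) ∞ β q

theorem single_apply_self (β : Σ n, cell n) (q : (Fin β.1 → ℝ) × ℝ) : single β q β = q := by
  classical
  exact lp.single_apply_self (E := fun β : Σ n, cell n => (Fin β.1 → ℝ) × ℝ) _ β q

theorem single_apply_ne {β γ : Σ n, cell n} (h : γ ≠ β) (q : (Fin β.1 → ℝ) × ℝ) :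
    single β q γ = 0 := by
  classical
  exact lp.single_apply_ne (E := fun β : Σ n, cell n => (Fin β.1 → ℝ) × ℝ) _ β q h

theorem single_zero (β : Σ n, cell n) : single β 0 = 0 := by
  classical
  exact lp.single_zero (E := fun β : Σ n, cell n => (Fin β.1 → ℝ) × ℝ) _ β

theorem continuous_single (β : Σ n, cell n) : Continuous (single β) := by
  classical
  exact (lp.isometry_single (E := fun β : Σ n, cell n => (Fin β.1 → ℝ) × ℝ) β).continuous

theorem dist_apply_le (w w' : CellCoordinates cell) (β : Σ n, cell n) :
    dist (w β) (w' β) ≤ dist w w' := by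
  rw [dist_eq_norm, dist_eq_norm]
  exact lp.norm_apply_le_norm (E := fun β : Σ n, cell n => (Fin β.1 → ℝ) × ℝ) (by simp) (w - w') β

theorem continuous_apply (β : Σ n, cell n) : Continuous fun w : CellCoordinates cell => w β :=
  (LipschitzWith.of_dist_le_mul (K := 1) fun w w' => by
    simpa using dist_apply_le w w' β).continuous

/-- The uniform margin `ε` gives openness in the sup norm even for infinite `P`; strict inequality
in each coordinate would not suffice. -/
theorem isOpen_smallOn (P : Set (Σ n, cell n)) : IsOpen (smallOn P) := by
  rw [Metric.isOpen_iff]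
  rintro w ⟨ε, hε, h⟩
  refine ⟨ε / 2, half_pos hε, fun w' hw' => ⟨ε / 2, half_pos hε, fun β hβ => ?_⟩⟩
  have h1 : dist (w' β).2 (w β).2 ≤ dist w' w := (le_max_right _ _).trans (dist_apply_le w' w β)
  have h2 := le_abs_self ((w' β).2 - (w β).2)
  rw [← Real.dist_eq] at h2
  have := h β hβ
  have : dist w' w < ε / 2 := hw'
  linarith

theorem smallOn_congr {P : Set (Σ n, cell n)} {w w' : CellCoordinates cell}
    (h : ∀ β ∈ P, w β = w' β) (hw : w ∈ smallOn P) : w' ∈ smallOn P := by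
  obtain ⟨ε, hε, h1⟩ := hw
  exact ⟨ε, hε, fun β hβ => h β hβ ▸ h1 β hβ⟩

theorem mem_smallOn_of_nonpos {P : Set (Σ n, cell n)} {w : CellCoordinates cell}
    (h : ∀ β ∈ P, (w β).2 ≤ 0) : w ∈ smallOn P :=
  ⟨1 / 4, by norm_num, fun β hβ => by simpa using h β hβ⟩

theorem lineMap_apply (w w' : CellCoordinates cell) (t : ℝ) (β : Σ n, cell n) :
    AffineMap.lineMap w w' t β = AffineMap.lineMap (w β) (w' β) t := by
  rw [AffineMap.lineMap_apply_module, AffineMap.lineMap_apply_module, add_apply, smul_apply,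
    smul_apply]

/-- The `n`-cells other than `j`. -/
abbrev otherCells {n : ℕ} (j : cell n) : Set (Σ n, cell n) := {β | β.1 = n ∧ β ≠ ⟨n, j⟩}

/-! ### Extending the retraction across the cells of one dimension. -/

open Set Topology in
/-- A map defined near the image of the `n`-skeleton extends to a neighbourhood of the image of the
next skeleton, given null homotopies of the attaching maps. -/
theorem exists_extension_retraction {K : Type*} [TopologicalSpace K] (n : ℕ)
    (W : Set (CellCoordinates cell)) (r : CellCoordinates cell → K) (hW : IsOpen W)
    (hr : ContinuousOn r W)
    (hcongr : ∀ w w', (∀ β, β.1 < n → w β = w' β) → w ∈ W → w' ∈ W ∧ r w' = r w)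
    (a : cell n → (Fin n → ℝ) → CellCoordinates cell)
    (ha : ∀ j, ContinuousOn (a j) (Metric.sphere 0 1))
    (E : cell n → (Fin n → ℝ) → K) (hE : ∀ j, Continuous (E j))
    (haE : ∀ j p, ‖p‖ = 1 → r (a j p) = E j ((2 : ℝ) • p)) :
    ∃ (W' : Set (CellCoordinates cell)) (r' : CellCoordinates cell → K), IsOpen W' ∧
      ContinuousOn r' W' ∧
      (∀ w w', (∀ β, β.1 < n + 1 → w β = w' β) → w ∈ W' → w' ∈ W' ∧ r' w' = r' w) ∧
      (∀ w ∈ W, w ∈ smallOn {β | β.1 = n} → w ∈ W' ∧ r' w = r w) ∧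
      (∀ (j : cell n) (w : CellCoordinates cell), w ∈ smallOn (otherCells j) →
        1 / 2 < (w ⟨n, j⟩).2 → w ∈ W' ∧ r' w = E j ((2 / max ‖(w ⟨n, j⟩).1‖
          ((w ⟨n, j⟩).2 * (2 * (w ⟨n, j⟩).2 - 1))) • (w ⟨n, j⟩).1)) ∧
      ∀ (j : cell n) (w : CellCoordinates cell), w ∈ smallOn (otherCells j) →
        (w ⟨n, j⟩).1 ≠ 0 → (w ⟨n, j⟩).2 ≤ 1 / 2 →
        segment ℝ w (a j (‖(w ⟨n, j⟩).1‖⁻¹ • (w ⟨n, j⟩).1)) ⊆ W →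
        w ∈ W' ∧ ∃ t : ℝ,
          AffineMap.lineMap w (a j (‖(w ⟨n, j⟩).1‖⁻¹ • (w ⟨n, j⟩).1)) t ∈ W ∧
          r' w = r (AffineMap.lineMap w (a j (‖(w ⟨n, j⟩).1‖⁻¹ • (w ⟨n, j⟩).1)) t) := by
  classical
  let v : (j : cell n) → CellCoordinates cell → (Fin n → ℝ) := fun j w => (w ⟨n, j⟩).1
  let τ : cell n → CellCoordinates cell → ℝ := fun j w => (w ⟨n, j⟩).2
  have hv : ∀ j, Continuous (v j) := fun j => (continuous_apply (⟨n, j⟩ : Σ n, cell n)).fst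
  have hτ : ∀ j, Continuous (τ j) := fun j => (continuous_apply (⟨n, j⟩ : Σ n, cell n)).snd
  let A : cell n → CellCoordinates cell → CellCoordinates cell :=
    fun j w => a j (‖v j w‖⁻¹ • v j w)
  have hA : ∀ j, ContinuousOn (A j) {w | v j w ≠ 0} := by
    intro j
    refine (ha j).comp (t := Metric.sphere 0 1) ?_
      fun w hw => by simpa using norm_inv_norm_smul hw
    exact ((hv j).norm.continuousOn.inv₀ fun w hw => norm_ne_zero_iff.2 hw).smul
      (hv j).continuousOn
  let ρ : cell n → CellCoordinates cell → K := fun j w =>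
    collarMap r (E j) w (A j w) (v j w) (τ j w)
  -- If the other `n`-cells are small, at most one `j` has `τ j w ≥ 1 / 4`, so the choice is forced;
  -- if none does, `ρ j` equals `r` anyway.
  let r' : CellCoordinates cell → K := fun w =>
    if h : ∃ j, 1 / 4 ≤ τ j w then ρ h.choose w else r w
  -- Three open regions: no `n`-cell active; near one cell with a direction and a segment inside
  -- `W`; deep in one cell, where no direction is needed.
  let S₀ : Set (CellCoordinates cell) := W ∩ smallOn {β | β.1 = n}
  let S₁ : cell n → Set (CellCoordinates cell) := fun j =>
    smallOn (otherCells j) ∩ ({w | v j w ≠ 0} ∩ (fun w => (w, A j w)) ⁻¹'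
      {p | segment ℝ p.1 p.2 ⊆ W})
  let S₂ : cell n → Set (CellCoordinates cell) := fun j =>
    smallOn (otherCells j) ∩ {w | 1 / 2 < τ j w}
  have hS₀ : IsOpen S₀ := hW.inter (isOpen_smallOn _)
  have hS₁ : ∀ j, IsOpen (S₁ j) := fun j => (isOpen_smallOn _).inter
    ((continuousOn_id.prodMk (hA j)).isOpen_inter_preimage (isOpen_ne_fun (hv j) continuous_const)
      (isOpen_setOf_segment_subset hW))
  have hS₂ : ∀ j, IsOpen (S₂ j) := fun j =>
    (isOpen_smallOn _).inter (isOpen_lt continuous_const (hτ j))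
  have hr₀ : ∀ w ∈ S₀, r' w = r w := by
    rintro w ⟨-, ε, hε, h⟩
    refine dif_neg ?_
    rintro ⟨j, hj⟩
    have : τ j w ≤ 1 / 4 - ε := h ⟨n, j⟩ rfl
    linarith
  have hrρ : ∀ j, ∀ w ∈ smallOn (otherCells j), r' w = ρ j w := by
    rintro j w ⟨ε, hε, h⟩
    have huniq : ∀ k, 1 / 4 ≤ τ k w → k = j := by
      intro k hk
      by_contra hne
      have : τ k w ≤ 1 / 4 - ε := h ⟨n, k⟩ ⟨rfl, by simpa using hne⟩
      linarith
    by_cases hex : ∃ k, 1 / 4 ≤ τ k w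
    · simp only [r', dif_pos hex]
      rw [huniq _ hex.choose_spec]
    · refine (dif_neg hex).trans (collarMap_of_lt _ _ _ _ _ ?_).symm
      by_contra! hle
      exact hex ⟨j, hle⟩
  have hρ₁ : ∀ j, ContinuousOn (ρ j) (S₁ j) := by
    intro j
    rw [continuousOn_iff_continuous_domRestrict]
    exact continuous_collarMap hr (hE j) continuous_subtype_val
      ((hA j).comp_continuous continuous_subtype_val fun w => w.2.2.1)
      ((hv j).comp continuous_subtype_val) ((hτ j).comp continuous_subtype_val)
      (fun w => w.2.2.1) (fun w => w.2.2.2)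
      (fun w => haE j _ (norm_inv_norm_smul w.2.2.1))
  have hρ₂ : ∀ j, ContinuousOn (ρ j) (S₂ j) := by
    intro j
    rw [continuousOn_iff_continuous_domRestrict]
    exact continuous_collarMap_of_half_lt (hE j) ((hv j).comp continuous_subtype_val)
      ((hτ j).comp continuous_subtype_val) fun w => w.2.2
  have hsmall : ∀ (P : Set (Σ n, cell n)) (w w' : CellCoordinates cell), (∀ β ∈ P, β.1 = n) →
      (∀ β, β.1 < n + 1 → w β = w' β) → w ∈ smallOn P → w' ∈ smallOn P :=
    fun P w w' hP h hw => smallOn_congr (fun β hβ => h β (by rw [hP β hβ]; exact n.lt_succ_self)) hw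
  have hlm : ∀ (w w' b : CellCoordinates cell) (t : ℝ), (∀ β, β.1 < n + 1 → w β = w' β) →
      AffineMap.lineMap w b t ∈ W →
        AffineMap.lineMap w' b t ∈ W ∧
          r (AffineMap.lineMap w' b t) = r (AffineMap.lineMap w b t) := by
    intro w w' b t h
    refine hcongr (AffineMap.lineMap w b t) (AffineMap.lineMap w' b t) fun β hβ => ?_
    rw [lineMap_apply, lineMap_apply, h β (hβ.trans n.lt_succ_self)]
  refine ⟨S₀ ∪ ((⋃ j, S₁ j) ∪ ⋃ j, S₂ j), r',
    hS₀.union ((isOpen_iUnion hS₁).union (isOpen_iUnion hS₂)), ?_, ?_, ?_, ?_, ?_⟩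
  · refine ContinuousOn.union_of_isOpen ((hr.mono inter_subset_left).congr hr₀)
      (ContinuousOn.union_of_isOpen (ContinuousOn.iUnion_of_isOpen (fun j => ?_) hS₁)
        (ContinuousOn.iUnion_of_isOpen (fun j => ?_) hS₂) (isOpen_iUnion hS₁) (isOpen_iUnion hS₂))
      hS₀ ((isOpen_iUnion hS₁).union (isOpen_iUnion hS₂))
    · exact (hρ₁ j).congr fun w hw => hrρ j w hw.1
    · exact (hρ₂ j).congr fun w hw => hrρ j w hw.1
  · intro w w' h hw
    have hcoord : ∀ j : cell n, w ⟨n, j⟩ = w' ⟨n, j⟩ := fun j => h ⟨n, j⟩ n.lt_succ_self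
    have hv' : ∀ j, v j w' = v j w := fun j => by simp only [v, hcoord]
    have hτ' : ∀ j, τ j w' = τ j w := fun j => by simp only [τ, hcoord]
    have hA' : ∀ j, A j w' = A j w := fun j => by simp only [A, hv']
    rcases hw with hw | hw | hw
    · have hc := hcongr w w' (fun β hβ => h β (hβ.trans n.lt_succ_self)) hw.1
      have hw' : w' ∈ S₀ := ⟨hc.1, hsmall _ w w' (fun _ hβ => hβ) h hw.2⟩
      exact ⟨Or.inl hw', by rw [hr₀ w' hw', hr₀ w hw, hc.2]⟩
    · obtain ⟨j, hw⟩ := mem_iUnion.1 hw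
      have hw' : w' ∈ S₁ j := by
        refine ⟨hsmall _ w w' (fun _ hβ => hβ.1) h hw.1, ?_, ?_⟩
        · change v j w' ≠ 0
          rw [hv']
          exact hw.2.1
        · change segment ℝ w' (A j w') ⊆ W
          have hseg : segment ℝ w (A j w) ⊆ W := hw.2.2
          rw [hA', segment_subset_iff_lineMap_mem]
          rw [segment_subset_iff_lineMap_mem] at hseg
          exact fun t ht => (hlm w w' _ t h (hseg t ht)).1
      refine ⟨Or.inr (Or.inl (mem_iUnion.2 ⟨j, hw'⟩)), ?_⟩
      rw [hrρ j w' hw'.1, hrρ j w hw.1]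
      have hmem : AffineMap.lineMap w (A j w) (max 0 (min 1 (4 * τ j w - 1))) ∈ W :=
        lineMap_max_min_mem hw.2.2 _
      simp only [ρ, hτ', hA', hv', collarMap]
      rw [(hlm w w' _ _ h hmem).2]
    · obtain ⟨j, hw⟩ := mem_iUnion.1 hw
      have hw2 : 1 / 2 < τ j w := hw.2
      have hw' : w' ∈ S₂ j := by
        refine ⟨hsmall _ w w' (fun _ hβ => hβ.1) h hw.1, ?_⟩
        change 1 / 2 < τ j w'
        rwa [hτ']
      refine ⟨Or.inr (Or.inr (mem_iUnion.2 ⟨j, hw'⟩)), ?_⟩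
      rw [hrρ j w' hw'.1, hrρ j w hw.1]
      simp only [ρ, hτ', hv', collarMap_of_half_lt _ _ _ _ _ hw2]
  · exact fun w hw hs => ⟨Or.inl ⟨hw, hs⟩, hr₀ w ⟨hw, hs⟩⟩
  · intro j w hw h
    refine ⟨Or.inr (Or.inr (mem_iUnion.2 ⟨j, hw, h⟩)), ?_⟩
    rw [hrρ j w hw]
    exact collarMap_of_half_lt _ _ _ _ _ h
  · intro j w hw hne hle hseg
    have hw₁ : w ∈ S₁ j := ⟨hw, hne, hseg⟩
    refine ⟨Or.inr (Or.inl (mem_iUnion.2 ⟨j, hw₁⟩)), _, lineMap_max_min_mem hseg (τ j w), ?_⟩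
    rw [hrρ j w hw]
    exact collarMap_of_le _ _ _ _ _ hle

end CellCoordinates

/-! ### Induction over skeleta. -/

namespace Topology.CWComplex

open Set Topology unitInterval CellCoordinates

universe u

/-- The `n`-skeleton (cells of dimension less than `n`) of `K`, as a homotopy retract of an open
set `W` of cell coordinates. -/
structure SkeletonDomination (K : Type u) [TopologicalSpace K] [T2Space K]
    [CWComplex (univ : Set K)] (n : ℕ) where
  i : K → CellCoordinates (RelCWComplex.cell (univ : Set K))
  W : Set (CellCoordinates (RelCWComplex.cell (univ : Set K)))
  r : CellCoordinates (RelCWComplex.cell (univ : Set K)) → K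
  -- Currying makes the homotopy a function on `K` alone, so its continuity can be tested cell by
  -- cell without a product with `I`.
  H : K → C(I, K)
  continuousOn_i : ContinuousOn i (RelCWComplex.skeletonLT (univ : Set K) n : Set K)
  i_apply_eq_zero : ∀ x ∈ (RelCWComplex.skeletonLT (univ : Set K) n : Set K), ∀ β, n ≤ β.1 →
    i x β = 0
  isOpen_W : IsOpen W
  continuousOn_r : ContinuousOn r W
  congr : ∀ w w', (∀ β, β.1 < n → w β = w' β) → w ∈ W → w' ∈ W ∧ r w' = r w
  i_mem : ∀ x ∈ (RelCWComplex.skeletonLT (univ : Set K) n : Set K), i x ∈ W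
  continuousOn_H : ContinuousOn H (RelCWComplex.skeletonLT (univ : Set K) n : Set K)
  H_zero : ∀ x ∈ (RelCWComplex.skeletonLT (univ : Set K) n : Set K), H x 0 = r (i x)
  H_one : ∀ x ∈ (RelCWComplex.skeletonLT (univ : Set K) n : Set K), H x 1 = x

variable {K : Type u} [TopologicalSpace K] [T2Space K] [CWComplex (univ : Set K)]

/-- The data `S'` on the next skeleton extend the data `S`. -/
structure SkeletonDomination.Extends {n : ℕ} (S : SkeletonDomination K n)
    (S' : SkeletonDomination K (n + 1)) : Prop where
  i_eq : ∀ x ∈ (RelCWComplex.skeletonLT (univ : Set K) n : Set K), S'.i x = S.i x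
  H_eq : ∀ x ∈ (RelCWComplex.skeletonLT (univ : Set K) n : Set K), S'.H x = S.H x
  r_eq : ∀ w ∈ S.W, w ∈ smallOn {β | β.1 = n} → w ∈ S'.W ∧ S'.r w = S.r w

/-- The old homotopy on an attaching sphere becomes a collar of radii 1 to 2, giving `E j` on all of
`ℝⁿ`. The new `r' ∘ i'` on a cell is `E j` after a radial stretch `μ`, and sliding `μ p` straight
back to `p` is the new homotopy. -/
theorem SkeletonDomination.exists_extends {n : ℕ} (S : SkeletonDomination K n) :
    ∃ S' : SkeletonDomination K (n + 1), S.Extends S' := by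
  let φ : ∀ j : RelCWComplex.cell (univ : Set K) n, (Fin n → ℝ) → K := fun j =>
    RelCWComplex.map n j
  have hφ : ∀ j, ContinuousOn (φ j) (Metric.closedBall 0 1) := RelCWComplex.continuousOn n
  have hφs : ∀ j p, ‖p‖ = 1 → φ j p ∈ (RelCWComplex.skeletonLT (univ : Set K) n : Set K) :=
    fun j p hp => RelCWComplex.cellFrontier_subset_skeletonLT n j ⟨p, by simpa using hp, rfl⟩
  have hφS : ∀ j, MapsTo (φ j) (Metric.sphere 0 1)
      (RelCWComplex.skeletonLT (univ : Set K) n : Set K) := fun j p hp =>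
    hφs j p (by simpa using hp)
  have hφc : ∀ j, ContinuousOn (φ j) (Metric.sphere 0 1) := fun j =>
    (hφ j).mono Metric.sphere_subset_closedBall
  choose E hE hEφ hEH using fun j => exists_continuous_collar_extension (hφ j)
    (S.continuousOn_H.comp (hφc j) (hφS j)) fun p hp => S.H_one _ (hφs j p hp)
  obtain ⟨W', r', hW', hr', hcongr', hold, htop, hmid⟩ :=
    exists_extension_retraction n S.W S.r S.isOpen_W S.continuousOn_r S.congr
      (fun j p => S.i (φ j p)) (fun j => S.continuousOn_i.comp (hφc j) (hφS j)) E hE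
      fun j p hp => by
        have := hEH j p 0 hp
        simp only [Icc.coe_zero, sub_zero, Function.comp_apply] at this
        rw [this, S.H_zero _ (hφs j p hp)]
  -- The old coordinates of the radial projection are damped only for `‖p‖ < 1 / 2`, while the new
  -- block has `τ = 1 - ‖p‖` and vanishes on the sphere.
  let q : ∀ j : RelCWComplex.cell (univ : Set K) n, (Fin n → ℝ) →
      CellCoordinates (RelCWComplex.cell (univ : Set K)) := fun j p =>
    min 1 (2 * ‖p‖) • S.i (φ j (‖p‖⁻¹ • p)) + single ⟨n, j⟩ ((1 - ‖p‖) • p, 1 - ‖p‖)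
  have hq : ∀ j, Continuous (q j) := fun j =>
    (continuous_min_norm_smul (f := fun p => S.i (φ j p))
      (S.continuousOn_i.comp (hφc j) (hφS j))).add
      ((continuous_single _).comp (by fun_prop))
  have hq0 : ∀ j p β, n ≤ β.1 → q j p β = single ⟨n, j⟩ ((1 - ‖p‖) • p, 1 - ‖p‖) β := by
    intro j p β hβ
    simp only [q, add_apply, smul_apply]
    by_cases hp : p = 0
    · simp [hp]
    · rw [S.i_apply_eq_zero _ (hφs j _ (norm_inv_norm_smul hp)) β hβ, smul_zero, zero_add]
  have hqself : ∀ j p, q j p ⟨n, j⟩ = ((1 - ‖p‖) • p, 1 - ‖p‖) := fun j p => by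
    rw [hq0 j p _ le_rfl, single_apply_self]
  have hqne : ∀ j p β, n ≤ β.1 → β ≠ ⟨n, j⟩ → q j p β = 0 := fun j p β hβ hne => by
    rw [hq0 j p _ hβ, single_apply_ne hne]
  have hqs : ∀ j p, ‖p‖ = 1 → q j p = S.i (φ j p) := by
    intro j p hp
    have : ((0 : Fin n → ℝ), (0 : ℝ)) = 0 := rfl
    simp only [q, hp, sub_self, zero_smul, inv_one, one_smul, this, single_zero, add_zero]
    norm_num
  obtain ⟨i', hi'c, hi'old, hi'new⟩ := exists_extension_skeletonLT_succ n S.i S.continuousOn_i q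
    (fun j => (hq j).continuousOn) hqs
  -- This is the rescaling in `collarMap` for `v = (1 - ‖p‖) • p` and `τ = 1 - ‖p‖`, with the factor
  -- `1 - ‖p‖` cancelled.
  let μ : (Fin n → ℝ) → (Fin n → ℝ) := fun p => (2 / max ‖p‖ (1 - 2 * ‖p‖)) • p
  have hpos : ∀ p : Fin n → ℝ, 0 < max ‖p‖ (1 - 2 * ‖p‖) := fun p => by
    by_contra! h
    have := le_max_left ‖p‖ (1 - 2 * ‖p‖)
    have := le_max_right ‖p‖ (1 - 2 * ‖p‖)
    linarith
  have hμ : Continuous μ :=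
    (continuous_const.div (by fun_prop) fun p => (hpos p).ne').smul continuous_id
  let G : ∀ j : RelCWComplex.cell (univ : Set K) n, C((Fin n → ℝ), C(I, K)) := fun j =>
    ContinuousMap.curry ⟨fun pt => E j ((1 - (pt.2 : ℝ)) • μ pt.1 + (pt.2 : ℝ) • pt.1),
      (hE j).comp (by fun_prop)⟩
  have hG : ∀ j p (t : I), G j p t = E j ((1 - (t : ℝ)) • μ p + (t : ℝ) • p) := fun _ _ _ => rfl
  -- On the sphere `μ p = 2 • p`, so the segment is `(2 - t) • p` and traces the collar, that is,
  -- the old homotopy.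
  have hGs : ∀ j p, ‖p‖ = 1 → G j p = S.H (φ j p) := by
    intro j p hp
    ext t
    have h2 : μ p = (2 : ℝ) • p := by
      simp only [μ, hp]
      norm_num
    rw [hG, h2, smul_smul, ← add_smul, ← Function.comp_apply (f := S.H), ← hEH j p t hp]
    congr 2
    ring
  obtain ⟨H', hH'c, hH'old, hH'new⟩ := exists_extension_skeletonLT_succ n S.H S.continuousOn_H
    (fun j => G j) (fun j => (G j).continuous.continuousOn) hGs
  have hold' : ∀ x ∈ (RelCWComplex.skeletonLT (univ : Set K) n : Set K),
      i' x ∈ W' ∧ r' (i' x) = S.r (S.i x) := by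
    intro x hx
    rw [hi'old x hx]
    refine hold _ (S.i_mem x hx) (mem_smallOn_of_nonpos fun β hβ => ?_)
    rw [S.i_apply_eq_zero x hx β (le_of_eq (Eq.symm hβ))]
    exact le_rfl
  have hnew : ∀ j p, ‖p‖ ≤ 1 → i' (φ j p) ∈ W' ∧ r' (i' (φ j p)) = E j (μ p) := by
    intro j p hp
    have hother : q j p ∈ smallOn (otherCells j) := mem_smallOn_of_nonpos fun β hβ => by
      rw [hqne j p β hβ.1.ge hβ.2]
      exact le_rfl
    rcases hp.lt_or_eq with hp | hp
    · rw [hi'new j p hp.le]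
      have h1p : 0 < 1 - ‖p‖ := by linarith
      rcases lt_or_ge ‖p‖ (1 / 2) with hlt | hge
      · have := htop j (q j p) hother (by rw [hqself]; dsimp only; linarith)
        refine ⟨this.1, this.2.trans (congrArg (E j) ?_)⟩
        rw [hqself]
        dsimp only [μ]
        rw [norm_smul, Real.norm_of_nonneg h1p.le, ← mul_max_of_nonneg _ _ h1p.le, smul_smul]
        congr 1
        rw [show 2 * (1 - ‖p‖) - 1 = 1 - 2 * ‖p‖ by ring]
        have := (hpos p).ne'
        field_simp
      · have hp0 : p ≠ 0 := norm_pos_iff.1 (by linarith)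
        have hdir : ‖(q j p ⟨n, j⟩).1‖⁻¹ • (q j p ⟨n, j⟩).1 = ‖p‖⁻¹ • p := by
          rw [hqself]
          dsimp only
          rw [norm_smul, Real.norm_of_nonneg h1p.le, smul_smul]
          congr 1
          have := norm_ne_zero_iff.2 hp0
          field_simp
        have hθ := hφs j _ (norm_inv_norm_smul hp0)
        -- For `‖p‖ ≥ 1 / 2` the damping factor is 1, so both ends of the segment have the same
        -- coordinates below dimension `n`, which are all that `S.r` sees.
        have hcl : ∀ t : ℝ, AffineMap.lineMap (q j p) (S.i (φ j (‖p‖⁻¹ • p))) t ∈ S.W ∧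
            S.r (AffineMap.lineMap (q j p) (S.i (φ j (‖p‖⁻¹ • p))) t) =
              S.r (S.i (φ j (‖p‖⁻¹ • p))) := by
          intro t
          refine S.congr (S.i (φ j (‖p‖⁻¹ • p))) _ (fun β hβ => ?_) (S.i_mem _ hθ)
          have hqβ : q j p β = S.i (φ j (‖p‖⁻¹ • p)) β := by
            simp only [q, add_apply, smul_apply]
            rw [single_apply_ne (fun h => by rw [h] at hβ; exact lt_irrefl _ hβ), add_zero,
              min_eq_left (by linarith), one_smul]
          rw [lineMap_apply, hqβ, AffineMap.lineMap_same_apply]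
        obtain ⟨hmem, t, ht, hrt⟩ := hmid j (q j p) hother
          (by rw [hqself]; exact smul_ne_zero h1p.ne' hp0)
          (by rw [hqself]; dsimp only; linarith)
          (by
            rw [hdir, segment_subset_iff_lineMap_mem]
            exact fun t _ => (hcl t).1)
        refine ⟨hmem, ?_⟩
        rw [hrt, hdir, (hcl t).2, ← S.H_zero _ hθ, ← Function.comp_apply (f := S.H),
          ← hEH j _ 0 (norm_inv_norm_smul hp0), smul_smul]
        dsimp only [μ]
        rw [max_eq_left (by linarith), Icc.coe_zero, sub_zero, div_eq_mul_inv]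
    · have hx := hφs j p hp
      refine ⟨(hold' _ hx).1, ?_⟩
      rw [(hold' _ hx).2, ← S.H_zero _ hx, ← hGs j p hp, hG]
      simp
  refine ⟨⟨i', W', r', H', hi'c, ?_, hW', hr', hcongr', ?_, hH'c, ?_, ?_⟩,
    ⟨hi'old, hH'old, hold⟩⟩
  · intro x hx β hβ
    rcases mem_skeletonLT_succ.1 hx with hx | ⟨j, p, hp, rfl⟩
    · rw [hi'old x hx, S.i_apply_eq_zero x hx β (by omega)]
    · rw [hi'new j p hp]
      exact hqne j p β (by omega) fun h => by
        rw [h] at hβ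
        exact Nat.not_succ_le_self _ hβ
  · intro x hx
    rcases mem_skeletonLT_succ.1 hx with hx | ⟨j, p, hp, rfl⟩
    · exact (hold' x hx).1
    · exact (hnew j p hp).1
  · intro x hx
    rcases mem_skeletonLT_succ.1 hx with hx | ⟨j, p, hp, rfl⟩
    · rw [hH'old x hx, S.H_zero x hx, (hold' x hx).2]
    · rw [hH'new j p hp, hG]
      refine Eq.trans ?_ (hnew j p hp).2.symm
      simp
  · intro x hx
    rcases mem_skeletonLT_succ.1 hx with hx | ⟨j, p, hp, rfl⟩
    · rw [hH'old x hx, S.H_one x hx]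
    · rw [hH'new j p hp, hG]
      refine Eq.trans ?_ (hEφ j p hp)
      simp

theorem exists_seq_skeletonDomination [Nonempty K] :
    ∃ S : ∀ n, SkeletonDomination K n, ∀ n, (S n).Extends (S (n + 1)) := by
  have hempty : (RelCWComplex.skeletonLT (univ : Set K) (0 : ℕ) : Set K) = ∅ :=
    CWComplex.skeletonLT_zero_eq_empty
  -- The starting skeleton is empty; a point of `K` is needed only to make `r` total.
  let S₀ : SkeletonDomination K 0 :=
    { i := fun _ => 0
      W := ∅
      r := fun _ => Classical.arbitrary K
      H := fun x => .const _ x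
      continuousOn_i := continuousOn_const
      i_apply_eq_zero := fun _ _ _ _ => rfl
      isOpen_W := isOpen_empty
      continuousOn_r := continuousOn_empty _
      congr := fun _ _ _ h => h.elim
      i_mem := fun x hx => (hempty.subset hx).elim
      continuousOn_H := ContinuousMap.const'.continuous.continuousOn
      H_zero := fun x hx => (hempty.subset hx).elim
      H_one := fun _ _ => rfl }
  choose next hnext using fun (n : ℕ) (S : SkeletonDomination K n) => S.exists_extends
  exact ⟨fun n => Nat.rec S₀ next n, fun n => hnext n _⟩

/-- A CW complex is a homotopy retract of an open subset of a normed space. -/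
theorem convexDominated (K : Type u) [TopologicalSpace K] [T2Space K]
    [CWComplex (univ : Set K)] : ConvexDominated.{u, u} K := by
  classical
  rcases isEmpty_or_nonempty K with hK | hK
  · refine ⟨PUnit, inferInstance, inferInstance, ∅, univ, convex_empty, isOpen_univ,
      ⟨fun x => hK.elim x, continuous_of_const fun x => hK.elim x⟩,
      ⟨fun x => x.2.1.elim, continuous_of_const fun x => x.2.1.elim⟩, ?_⟩
    convert ContinuousMap.Homotopic.refl _
    ext x
    exact hK.elim x
  obtain ⟨S, hS⟩ := exists_seq_skeletonDomination (K := K)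
  let A : ℕ → Set K := fun n => RelCWComplex.skeletonLT (univ : Set K) n
  have hAmono : ∀ {n m : ℕ}, n ≤ m → A n ⊆ A m := fun h =>
    RelCWComplex.skeletonLT_mono (by exact_mod_cast h)
  have hA : ∀ x, ∃ n, x ∈ A n := fun x => by
    have : x ∈ ⋃ n : ℕ, (RelCWComplex.skeletonLT (univ : Set K) n : Set K) := by
      rw [RelCWComplex.iUnion_skeletonLT_eq_complex]
      exact mem_univ x
    exact mem_iUnion.1 this
  have hi : ∀ {n m : ℕ}, n ≤ m → ∀ x ∈ A n, (S m).i x = (S n).i x ∧ (S m).H x = (S n).H x := by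
    intro n m h x hx
    induction m, h using Nat.le_induction with
    | base => exact ⟨rfl, rfl⟩
    | succ m h ih =>
      exact ⟨((hS m).i_eq x (hAmono h hx)).trans ih.1, ((hS m).H_eq x (hAmono h hx)).trans ih.2⟩
  have hr : ∀ {n m : ℕ}, n ≤ m → ∀ w ∈ (S n).W, w ∈ smallOn {β | n ≤ β.1} →
      w ∈ (S m).W ∧ (S m).r w = (S n).r w := by
    intro n m h w hw hs
    induction m, h using Nat.le_induction with
    | base => exact ⟨hw, rfl⟩
    | succ m h ih =>
      obtain ⟨ε, hε, hs⟩ := hs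
      have := (hS m).r_eq w ih.1 ⟨ε, hε, fun β hβ => hs β (h.trans hβ.ge)⟩
      exact ⟨this.1, this.2.trans ih.2⟩
  -- Where all cells of dimension at least `n` are small, every later stage keeps the value of stage
  -- `n`, so the maps glue on this union.
  let O : Set (CellCoordinates (RelCWComplex.cell (univ : Set K))) :=
    ⋃ n, (S n).W ∩ smallOn {β | n ≤ β.1}
  have hOn : ∀ n, IsOpen ((S n).W ∩ smallOn {β | n ≤ β.1}) := fun n =>
    (S n).isOpen_W.inter (isOpen_smallOn _)
  let r : CellCoordinates (RelCWComplex.cell (univ : Set K)) → K := fun w =>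
    if h : ∃ n, w ∈ (S n).W ∩ smallOn {β | n ≤ β.1} then (S h.choose).r w
    else Classical.arbitrary K
  have hrn : ∀ n, ∀ w ∈ (S n).W ∩ smallOn {β | n ≤ β.1}, r w = (S n).r w := by
    intro n w hw
    have hex : ∃ n, w ∈ (S n).W ∩ smallOn {β | n ≤ β.1} := ⟨n, hw⟩
    refine (dif_pos hex).trans ?_
    rcases le_total n hex.choose with h | h
    · exact (hr h w hw.1 hw.2).2
    · exact (hr h w hex.choose_spec.1 hex.choose_spec.2).2.symm
  have hrc : ContinuousOn r O := ContinuousOn.iUnion_of_isOpen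
    (fun n => ((S n).continuousOn_r.mono inter_subset_left).congr (hrn n)) hOn
  choose N hN using hA
  -- Each closed cell lies in one skeleton, and closedness in `K` is tested on closed cells; this
  -- serves both `i` and the curried `H`.
  have hcont : ∀ {T : Type u} [TopologicalSpace T] (g : ℕ → K → T)
      (_ : ∀ n, ContinuousOn (g n) (A n))
      (_ : ∀ {n m : ℕ}, n ≤ m → ∀ x ∈ A n, g m x = g n x), Continuous fun x => g (N x) x := by
    intro T _ g hg hgm
    have hgn : ∀ n, ∀ x ∈ A n, g (N x) x = g n x := fun n x hx => by
      rcases le_total n (N x) with h | h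
      · exact hgm h x hx
      · exact (hgm h x (hN x)).symm
    rw [continuous_iff_isClosed]
    intro F hF
    refine CWComplex.isClosed_of_disjoint_openCell_or_isClosed_inter_closedCell (subset_univ _)
      fun m _ j => Or.inr ?_
    have hsub : RelCWComplex.closedCell (C := (univ : Set K)) m j ⊆ A (m + 1) := by
      have := RelCWComplex.closedCell_subset_skeletonLT (C := (univ : Set K)) m j
      exact_mod_cast this
    have hco : ContinuousOn (fun x => g (N x) x) (RelCWComplex.closedCell m j) :=
      ((hg (m + 1)).mono hsub).congr fun x hx => hgn (m + 1) x (hsub hx)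
    rw [inter_comm]
    exact hco.preimage_isClosed_of_isClosed RelCWComplex.isClosed_closedCell hF
  have hic := hcont (fun n => (S n).i) (fun n => (S n).continuousOn_i) fun h x hx => (hi h x hx).1
  have hHc := hcont (fun n => (S n).H) (fun n => (S n).continuousOn_H) fun h x hx => (hi h x hx).2
  have hiO : ∀ x, (S (N x)).i x ∈ (S (N x)).W ∩ smallOn {β | N x ≤ β.1} := fun x =>
    ⟨(S (N x)).i_mem x (hN x), mem_smallOn_of_nonpos fun β hβ => by
      rw [(S (N x)).i_apply_eq_zero x (hN x) β hβ]
      exact le_rfl⟩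
  refine ⟨_, inferInstance, inferInstance, univ, O, convex_univ, isOpen_iUnion hOn,
    ⟨fun x => ⟨(S (N x)).i x, mem_univ _, mem_iUnion.2 ⟨_, hiO x⟩⟩, hic.subtype_mk _⟩,
    ⟨fun w => r w, hrc.comp_continuous continuous_subtype_val fun w => w.2.2⟩,
    ⟨⟨⟨fun p => (S (N p.2)).H p.2 p.1, ?_⟩, fun x => ?_, fun x => ?_⟩⟩⟩
  · exact (ContinuousEval.continuous_eval (F := C(I, K))).comp
      ((hHc.comp continuous_snd).prodMk continuous_fst)
  · exact ((S (N x)).H_zero x (hN x)).trans (hrn _ _ (hiO x)).symm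
  · exact (S (N x)).H_one x (hN x)

end Topology.CWComplex

/-! ### Conclusion for both homotopy types. -/

theorem HasHomotopyTypeOfCW.convexDominated.{u} {X : Type u} [TopologicalSpace X]
    (hX : HasHomotopyTypeOfCW X) : ConvexDominated.{u, u} X := by
  obtain ⟨K, _, _, ⟨_⟩, ⟨e⟩⟩ := hX
  exact (Topology.CWComplex.convexDominated K).of_homotopyEquiv e

theorem HasHomotopyTypeOfANR.convexDominated.{u} {X : Type u} [TopologicalSpace X]
    (hX : HasHomotopyTypeOfANR X) : ConvexDominated.{u, u} X := by
  obtain ⟨K, _, hK, ⟨e⟩⟩ := hX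
  exact hK.convexDominated.of_homotopyEquiv e

theorem mainTheorem11 {X Y : Type*} [TopologicalSpace X] [TopologicalSpace Y]
    (hX : HasHomotopyTypeOfCW X ∨ HasHomotopyTypeOfANR X)
    (hY : HasHomotopyTypeOfCW Y ∨ HasHomotopyTypeOfANR Y)
    (f : C(X, Y)) :
    secat f = secatGen f :=
  secat_eq_secatGen_of_convexDominated
    (hX.elim HasHomotopyTypeOfCW.convexDominated HasHomotopyTypeOfANR.convexDominated)
    (hY.elim HasHomotopyTypeOfCW.convexDominated HasHomotopyTypeOfANR.convexDominated) f
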